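/- Let $E$ be a real linear space and $d\in\mathbb N$, $d\ge 1$. A function $f:F\to\mathbb C$ on a real linear space $F$ is called positive definite, $f\in\Phi(F)$, if $\sum_{i,j=1}^n a_i f(\xi_i-\xi_j)\overline{a_j}$ is real and $\ge 0$ for all $n$, all $\xi_1,\dots,\xi_n\in F$ and all $a_1,\dots,a_n\in\mathbb C$; and $h\in C(E)$ means that the restriction of $h:E\to\mathbb R$ to every finite-dimensional linear subspace of $E$ is continuous (in coordinates with respect to a basis). Suppose that 1. $h\in C(E)$, $h(t)>0$ for all $t\in E$, and $h$ is not identically equal to $h(0)$; 2. $\varphi:[0,\infty)\to\mathbb R$ is continuous and $\varphi(0)>0$; 3. the function $K(x,t):=h(t)^{-d/2}\,\varphi\!\left(\|x\|_2^2/h(t)\right)$ belongs to $\Phi(\mathbb R^d\times E)$, where $\|\cdot\|_2$ is the Euclidean norm. Let $m$ be an integer with $1\le m\le d$ and $\int_0^\infty|\varphi(u^2)|\,u^{m-1}\,du<\infty$, and put $$g_m(s):=\int_0^\infty \varphi(u^2)\,u^{m-1}\,j_{\frac m2-1}(su)\,du,\qquad s>0,\qquad j_\lambda(u):=\frac{J_\lambda(u)}{u^\lambda},$$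 where $J_\lambda$ is the Bessel function of the first kind. If $g_m$ is real-analytic on $(0,\infty)$, then the function $s\mapsto s^{m-d}g_m(s)$ is strictly decreasing on $(0,\infty)$, and $g_m(s)>0$ for all $s>0$. -/

import Mathlib

noncomputable section

/-- A complex-valued function `f` on a real linear space is positive definite (`f ∈ Φ(E)`) if
`∑ i j, a i * f (ξ i - ξ j) * conj (a j)` is real and nonnegative for all finite families of
points `ξ i` and complex numbers `a i`. No continuity is required. -/
def IsPositiveDefiniteFun {E : Type*} [AddCommGroup E] (f : E → ℂ) : Prop :=
  ∀ (n : ℕ) (ξ : Fin n → E) (a : Fin n → ℂ),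
    0 ≤ (∑ i, ∑ j, a i * f (ξ i - ξ j) * (starRingEnd ℂ) (a j)).re ∧
      (∑ i, ∑ j, a i * f (ξ i - ξ j) * (starRingEnd ℂ) (a j)).im = 0

/-- `f ∈ C(E)` for a real linear space `E` of any dimension: on each finite-dimensional linear
subspace `E₀`, `f` is continuous as a function of the coordinates in a basis of `E₀`. -/
def IsFinitelyContinuous {E : Type*} [AddCommGroup E] [Module ℝ E] (f : E → ℝ) : Prop :=
  ∀ (E₀ : Submodule ℝ E) (n : ℕ) (e : Module.Basis (Fin n) ℝ E₀),
    Continuous (fun x : Fin n → ℝ => f (∑ i, x i • (e i : E)))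

/-- The Bessel function of the first kind `J_ν(x)` of real order `ν`, for `x > 0`, by its series
`∑ k, (-1)^k / (k! Γ(k + ν + 1)) (x / 2)^(2k + ν)`. (At the poles of `Γ`, Mathlib's value
`Γ = 0` gives the usual convention `1 / Γ = 0`.) -/
def besselJ (ν x : ℝ) : ℝ :=
  ∑' k : ℕ, (-1 : ℝ) ^ k / ((k.factorial : ℝ) * Real.Gamma ((k : ℝ) + ν + 1)) *
    (x / 2) ^ (2 * (k : ℝ) + ν)

/-- `j_ν(u) = J_ν(u) / u^ν`, for `u > 0`. -/
def besselj (ν u : ℝ) : ℝ := besselJ ν u / u ^ ν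

/-- The Bessel integral `g_m(s) = ∫_0^∞ φ(u²) u^(m-1) j_{m/2-1}(s u) du`, for `m ≥ 1`, `s > 0`. -/
def besselIntegral (φ : ℝ → ℝ) (m : ℕ) (s : ℝ) : ℝ :=
  ∫ u in Set.Ioi (0 : ℝ), φ (u ^ 2) * u ^ (m - 1) * besselj ((m : ℝ) / 2 - 1) (s * u)

end

/-! Put `G s = s ^ (m - d) * g_m s`. Restrict `K` to an `m`-dimensional subspace of `ℝ^d`, where `φ
(‖x‖ ^ 2)` becomes integrable, and take the Fourier transform in `x` at a frequency `w ≠ 0`. The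
result is positive definite in `t`, hence bounded in absolute value by its value at `t = 0`. By
scaling it equals a positive constant times `√(h t) ^ (m - d) * g_m (√(h t) * ‖w‖)`, so `|G (s * √(h
t / h 0))| ≤ G s` (`abs_zpow_mul_besselIntegral_dilation_le`).

In particular `G ≥ 0`. Since `K (0, t)` is maximal at `t = 0`, `h` is minimal there; as `h` is not
constant and is continuous along a ray, the factors `√(h t / h 0)` fill an interval `[1, q₀]` with
`q₀ > 1`, and iterating the dilations shows that `G` decreases. By analyticity it decreases strictly
or is constant. Constancy would mean `g_m s = c * s ^ (d - m)`: Riemann–Lebesgue forces `c = 0`, and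
injectivity of the Fourier transform then gives `φ 0 = 0`, a contradiction. A strictly decreasing
nonnegative function is positive.

Positivity of the transform needs only that an integrable positive definite function has nonnegative
integral (`integral_nonneg_of_sum_sub_nonneg`). -/

open MeasureTheory Filter Topology
open scoped RealInnerProductSpace

/-! ### Integrals of positive definite functions -/

/-- Averaging over `n` independent points with law `P` and letting `n → ∞`. -/
lemma integral_prod_sub_nonneg {V : Type*} [AddGroup V] [MeasurableSpace V] [MeasurableSub₂ V]
    (P : Measure V) [IsProbabilityMeasure P] {g : V → ℝ} (hg : Measurable g) {C : ℝ}
    (hC : ∀ x, |g x| ≤ C)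
    (hpos : ∀ (n : ℕ) (x : Fin n → V), 0 ≤ ∑ i, ∑ j, g (x i - x j)) :
    0 ≤ ∫ p, g (p.1 - p.2) ∂(P.prod P) := by
  set I := ∫ p, g (p.1 - p.2) ∂(P.prod P) with hI
  -- The `n` diagonal terms equal `g 0`; each of the `n (n - 1)` others has mean `I` by
  -- independence. A negative `I` would win for large `n`.
  have key : ∀ n : ℕ, 0 ≤ (n : ℝ) * g 0 + (n : ℝ) * ((n : ℝ) - 1) * I := by
    intro n
    have hint : ∀ i j : Fin n, Integrable (fun x : Fin n → V => g (x i - x j))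
        (Measure.pi fun _ => P) := fun i j =>
      Integrable.of_bound (hg.comp (by fun_prop)).aestronglyMeasurable C
        (Eventually.of_forall fun x => hC _)
    have h1 : ∀ i j : Fin n, ∫ x : Fin n → V, g (x i - x j) ∂(Measure.pi fun _ => P)
        = if i = j then g 0 else I := by
      intro i j
      split_ifs with hij
      · simp [hij]
      · have hind := (ProbabilityTheory.iIndepFun_pi (μ := fun _ : Fin n => P)
          (X := fun _ => id) (fun _ => aemeasurable_id)).indepFun hij
        have hmap : Measure.map (fun ω : Fin n → V => (ω i, ω j)) (Measure.pi fun _ => P)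
            = (Measure.map (fun ω => ω i) (Measure.pi fun _ => P)).prod
              (Measure.map (fun ω => ω j) (Measure.pi fun _ => P)) :=
          (ProbabilityTheory.indepFun_iff_map_prod_eq_prod_map_map
          (measurable_pi_apply i).aemeasurable (measurable_pi_apply j).aemeasurable).1 hind
        have e1 : Measure.map (fun ω : Fin n → V => ω i) (Measure.pi fun _ => P) = P :=
          (measurePreserving_eval (fun _ : Fin n => P) i).map_eq
        have e2 : Measure.map (fun ω : Fin n → V => ω j) (Measure.pi fun _ => P) = P :=
          (measurePreserving_eval (fun _ : Fin n => P) j).map_eq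
        rw [e1, e2] at hmap
        rw [hI, ← hmap, integral_map (f := fun p : V × V => g (p.1 - p.2)) (by fun_prop)
          (hg.comp measurable_sub).aestronglyMeasurable]
    have h2 : 0 ≤ ∫ x : Fin n → V, ∑ i, ∑ j, g (x i - x j) ∂(Measure.pi fun _ => P) :=
      integral_nonneg fun x => hpos n x
    rw [integral_finsetSum _ fun i _ => integrable_finsetSum _ fun j _ => hint i j] at h2
    simp_rw [integral_finsetSum _ fun j _ => hint _ j, h1] at h2
    have h3 : ∀ i : Fin n, ∑ j, (if i = j then g 0 else I) = g 0 + ((n : ℝ) - 1) * I := by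
      intro i
      have : ∀ j, (if i = j then g 0 else I) = (if i = j then g 0 - I else 0) + I := by
        intro j; split_ifs <;> ring
      simp_rw [this, Finset.sum_add_distrib]
      simp; ring
    simp_rw [h3] at h2
    simp at h2
    linarith
  by_contra hneg
  push Not at hneg
  obtain ⟨n, hn⟩ := exists_nat_gt (|g 0| / (-I) + 1)
  have hn1 : 1 < (n : ℝ) := lt_of_le_of_lt (by
    have : 0 ≤ |g 0| / (-I) := div_nonneg (abs_nonneg _) (by linarith)
    linarith) hn
  have h4 : |g 0| < ((n : ℝ) - 1) * (-I) := by
    rw [← div_lt_iff₀ (by linarith)]; linarith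
  have h5 := key n
  have h6 : 0 ≤ (n : ℝ) * (g 0 + ((n : ℝ) - 1) * I) := by linarith
  have h7 : 0 ≤ g 0 + ((n : ℝ) - 1) * I := nonneg_of_mul_nonneg_right h6 (by linarith)
  linarith [le_abs_self (g 0)]

section
variable {V : Type*} [NormedAddCommGroup V] [InnerProductSpace ℝ V] [FiniteDimensional ℝ V]
  [MeasurableSpace V] [BorelSpace V]

lemma integrable_exp_neg_mul_norm_sq {ε : ℝ} (hε : 0 < ε) :
    Integrable (fun v : V => Real.exp (-ε * ‖v‖ ^ 2)) := by
  have h := (GaussianFourier.integrable_cexp_neg_mul_sq_norm_add (V := V) (b := (ε : ℂ))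
    (by simpa using hε) 0 0).norm
  refine h.congr (Eventually.of_forall fun v => ?_)
  simp [Complex.norm_exp, ← Complex.ofReal_pow]

/-- For two independent points with density proportional to `exp (-ε ‖v‖ ^ 2)`, the difference has
density proportional to `exp (-(ε / 2) ‖z‖ ^ 2)`. -/
lemma integral_mul_exp_neg_norm_sq_nonneg {g : V → ℝ} (hg : Measurable g) (hgi : Integrable g)
    {C : ℝ} (hC : ∀ x, |g x| ≤ C)
    (hpos : ∀ (n : ℕ) (x : Fin n → V), 0 ≤ ∑ i, ∑ j, g (x i - x j)) {ε : ℝ} (hε : 0 < ε) :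
    0 ≤ ∫ z, g z * Real.exp (-(ε / 2) * ‖z‖ ^ 2) := by
  set γ : V → ℝ := fun v => -ε * ‖v‖ ^ 2 with hγ
  have hγi : Integrable (fun v => Real.exp (γ v)) := integrable_exp_neg_mul_norm_sq hε
  have : IsProbabilityMeasure ((volume : Measure V).tilted γ) := isProbabilityMeasure_tilted hγi
  set Z := ∫ v, Real.exp (γ v) with hZ
  have hZpos : 0 < Z := integral_exp_pos hγi
  have h := integral_prod_sub_nonneg ((volume : Measure V).tilted γ) hg hC hpos
  rw [integral_prod (fun p : V × V => g (p.1 - p.2))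
    (Integrable.of_bound (hg.comp measurable_sub).aestronglyMeasurable C
    (Eventually.of_forall fun x => hC _))] at h
  simp only [integral_tilted, smul_eq_mul] at h
  rw [← hZ] at h
  have e1 : ∀ x : V, Real.exp (γ x) / Z * ∫ y, Real.exp (γ y) / Z * g (x - y)
      = Z⁻¹ * Z⁻¹ * ∫ z, g z * Real.exp (γ x + γ (x - z)) := by
    intro x
    rw [← integral_sub_left_eq_self (fun y => Real.exp (γ y) / Z * g (x - y)) _ x, ← integral_const_mul,
      ← integral_const_mul]
    congr 1; ext z
    simp only [sub_sub_cancel, Real.exp_add]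
    field_simp
  simp_rw [e1] at h
  rw [integral_const_mul, integral_integral_swap] at h
  -- Complete the square: `‖x‖² + ‖x - z‖² = 2 ‖x - z/2‖² + ‖z‖² / 2`.
  · have e2 : ∀ z : V, ∫ x, g z * Real.exp (γ x + γ (x - z))
        = (g z * Real.exp (-(ε / 2) * ‖z‖ ^ 2)) * ∫ x : V, Real.exp (-(2 * ε) * ‖x‖ ^ 2) := by
      intro z
      rw [← integral_sub_right_eq_self (fun x : V => Real.exp (-(2 * ε) * ‖x‖ ^ 2)) ((1/2 : ℝ) • z),
        ← integral_const_mul]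
      congr 1; ext x
      rw [mul_assoc, ← Real.exp_add]
      congr 2
      simp only [hγ, @norm_sub_sq_real, norm_smul, inner_smul_right]
      rw [Real.norm_of_nonneg (by norm_num)]
      ring
    simp_rw [e2] at h
    rw [integral_mul_const] at h
    have hpos2 : 0 < ∫ x : V, Real.exp (-(2 * ε) * ‖x‖ ^ 2) :=
      integral_exp_pos (integrable_exp_neg_mul_norm_sq (by positivity))
    have hZ2 : 0 < Z⁻¹ * Z⁻¹ := by positivity
    exact nonneg_of_mul_nonneg_left (nonneg_of_mul_nonneg_right h hZ2) hpos2
  · have hm : AEStronglyMeasurable (Function.uncurry fun x z : V =>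
        g z * Real.exp (γ x + γ (x - z))) ((volume : Measure V).prod volume) := by
      apply Measurable.aestronglyMeasurable
      simp only [Function.uncurry_def, hγ]
      fun_prop
    refine (hγi.mul_prod hgi).mono hm (Eventually.of_forall fun p => ?_)
    simp only [Function.uncurry, norm_mul, Real.norm_eq_abs, Real.abs_exp]
    rw [mul_comm]
    gcongr
    simp only [hγ]
    nlinarith [mul_nonneg hε.le (sq_nonneg ‖p.1 - p.2‖)]

/-- An integrable positive definite function has nonnegative integral. -/
lemma integral_nonneg_of_sum_sub_nonneg {g : V → ℝ} (hg : Measurable g) (hgi : Integrable g)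
    {C : ℝ} (hC : ∀ x, |g x| ≤ C)
    (hpos : ∀ (n : ℕ) (x : Fin n → V), 0 ≤ ∑ i, ∑ j, g (x i - x j)) :
    0 ≤ ∫ z, g z := by
  have hlim : Tendsto (fun n : ℕ => ∫ z, g z * Real.exp (-((1 / ((n : ℝ) + 1)) / 2) * ‖z‖ ^ 2))
      atTop (𝓝 (∫ z, g z)) := by
    refine tendsto_integral_of_dominated_convergence (fun z => |g z|) ?_ hgi.abs ?_ ?_
    · intro n; fun_prop
    · intro n
      refine Eventually.of_forall fun z => ?_
      rw [norm_mul, Real.norm_eq_abs, Real.norm_eq_abs, Real.abs_exp]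
      refine mul_le_of_le_one_right (abs_nonneg _) (Real.exp_le_one_iff.2 ?_)
      have : 0 ≤ (1 / ((n : ℝ) + 1)) / 2 * ‖z‖ ^ 2 := by positivity
      linarith
    · refine Eventually.of_forall fun z => ?_
      have h1 : Tendsto (fun n : ℕ => -((1 / ((n : ℝ) + 1)) / 2) * ‖z‖ ^ 2) atTop
          (𝓝 (-(0 / 2) * ‖z‖ ^ 2)) :=
        ((tendsto_one_div_add_atTop_nhds_zero_nat.div_const 2).neg).mul_const _
      have h2 := ((Real.continuous_exp.tendsto _).comp h1).const_mul (g z)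
      simpa using h2
  exact ge_of_tendsto' hlim fun n =>
    integral_mul_exp_neg_norm_sq_nonneg hg hgi hC hpos (by positivity)
end

/-! ### Polar coordinates -/

section
variable {V : Type*} [NormedAddCommGroup V] [NormedSpace ℝ V] [Nontrivial V]
  [FiniteDimensional ℝ V] [MeasurableSpace V] [BorelSpace V]

/-- Integration in polar coordinates. -/
lemma integral_eq_integral_toSphere (μ : Measure V) [μ.IsAddHaarMeasure] {f : V → ℝ}
    (hf : Integrable f μ) :
    ∫ x, f x ∂μ = ∫ r in Set.Ioi (0 : ℝ), r ^ (Module.finrank ℝ V - 1) *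
      ∫ ω : Metric.sphere (0 : V) 1, f (r • (ω : V)) ∂μ.toSphere := by
  have hmp := μ.measurePreserving_homeomorphUnitSphereProd
  have hemb : MeasurableEmbedding (homeomorphUnitSphereProd V) :=
    Homeomorph.measurableEmbedding _
  have hfun : ∀ x : ({0}ᶜ : Set V), f x = (fun p : Metric.sphere (0 : V) 1 × Set.Ioi (0 : ℝ) =>
      f ((p.2 : ℝ) • (p.1 : V))) (homeomorphUnitSphereProd V x) := by
    intro x
    have hx : ‖(x : V)‖ ≠ 0 := norm_ne_zero_iff.2 x.2
    simp [smul_smul, hx]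
  have hint : Integrable (fun p : Metric.sphere (0 : V) 1 × Set.Ioi (0 : ℝ) =>
      f ((p.2 : ℝ) • (p.1 : V)))
      (μ.toSphere.prod (Measure.volumeIoiPow (Module.finrank ℝ V - 1))) := by
    rw [← hmp.integrable_comp_emb hemb]
    have h0 : IntegrableOn f ({0}ᶜ : Set V) μ := hf.integrableOn
    rw [integrableOn_iff_comap_subtypeVal (by measurability)] at h0
    exact h0.congr (Eventually.of_forall hfun)
  calc ∫ x, f x ∂μ = ∫ x : ({(0)}ᶜ : Set V), f x ∂(μ.comap (↑)) := by
        rw [integral_subtype_comap (measurableSet_singleton _).compl f,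
          restrict_compl_singleton]
    _ = ∫ p, f ((p.2 : ℝ) • (p.1 : V))
          ∂(μ.toSphere.prod (Measure.volumeIoiPow (Module.finrank ℝ V - 1))) := by
        rw [← hmp.integral_comp hemb]
        exact integral_congr_ae (Eventually.of_forall hfun)
    _ = ∫ r : Set.Ioi (0 : ℝ), ∫ ω, f ((r : ℝ) • (ω : V)) ∂μ.toSphere
          ∂Measure.volumeIoiPow (Module.finrank ℝ V - 1) := integral_prod_symm _ hint
    _ = _ := by
        simp only [Measure.volumeIoiPow, ENNReal.ofReal]
        rw [integral_withDensity_eq_integral_smul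
            ((measurable_subtype_coe.pow_const _).real_toNNReal),
          integral_subtype_comap measurableSet_Ioi fun a : ℝ =>
            Real.toNNReal (a ^ (Module.finrank ℝ V - 1)) • ∫ ω, f (a • (ω : V)) ∂μ.toSphere]
        refine setIntegral_congr_fun measurableSet_Ioi fun x hx => ?_
        simp only [NNReal.smul_def, smul_eq_mul]
        rw [Real.coe_toNNReal _ (pow_nonneg (le_of_lt hx) _)]
end

/-! ### Gaussian moments, spherical moments and the Bessel function -/

lemma integrableOn_pow_mul_exp_neg_sq (n : ℕ) :
    IntegrableOn (fun r : ℝ => r ^ n * Real.exp (-r ^ 2)) (Set.Ioi 0) := by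
  have h := (integrable_rpow_mul_exp_neg_mul_sq (b := 1) one_pos (s := n)
    (by have : (0 : ℝ) ≤ n := n.cast_nonneg
        linarith)).integrableOn (s := Set.Ioi 0)
  simpa using h

lemma integral_Ioi_pow_mul_exp_neg_sq (n : ℕ) :
    ∫ r in Set.Ioi (0 : ℝ), r ^ n * Real.exp (-r ^ 2) = Real.Gamma (((n : ℝ) + 1) / 2) / 2 := by
  have h := integral_rpow_mul_exp_neg_rpow (p := 2) (q := n) two_pos
    (by have : (0 : ℝ) ≤ n := n.cast_nonneg
        linarith)
  simp only [Real.rpow_natCast, Real.rpow_ofNat] at h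
  rw [h]; ring

lemma integral_pow_two_mul_mul_exp_neg_sq (k : ℕ) :
    ∫ t : ℝ, t ^ (2 * k) * Real.exp (-t ^ 2) = Real.Gamma (k + 1 / 2) := by
  have h := integral_comp_abs (f := fun t : ℝ => t ^ (2 * k) * Real.exp (-t ^ 2))
  simp only [sq_abs, pow_mul] at h
  simp only [pow_mul]
  rw [h]
  have h2 := integral_Ioi_pow_mul_exp_neg_sq (2 * k)
  simp only [pow_mul] at h2
  rw [h2]
  push_cast
  rw [show ((2 : ℝ) * k + 1) / 2 = k + 1 / 2 by ring]
  ring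

lemma Gamma_nat_add_half_eq_factorial (k : ℕ) :
    Real.Gamma (k + 1 / 2) = ((2 * k).factorial : ℝ) * √Real.pi / (4 ^ k * k.factorial) := by
  induction k with
  | zero => simp [-one_div, Real.Gamma_one_half_eq]
  | succ k ih =>
    rw [show ((k + 1 : ℕ) : ℝ) + 1 / 2 = (k + 1 / 2) + 1 by push_cast; ring,
      Real.Gamma_add_one (by positivity), ih, show 2 * (k + 1) = 2 * k + 1 + 1 by ring,
      Nat.factorial_succ, Nat.factorial_succ, Nat.factorial_succ]
    push_cast
    field_simp
    ring

section
variable {V : Type*} [NormedAddCommGroup V] [InnerProductSpace ℝ V]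
  [FiniteDimensional ℝ V] [MeasurableSpace V] [BorelSpace V]

lemma integrable_inner_pow_mul_exp_neg_norm_sq [Nontrivial V] (w : V) (k : ℕ) :
    Integrable (fun x : V => ⟪w, x⟫ ^ k * Real.exp (-‖x‖ ^ 2)) := by
  have h1 : Integrable (fun x : V => (fun r : ℝ => (‖w‖ * r) ^ k * Real.exp (-r ^ 2)) ‖x‖) := by
    rw [integrable_fun_norm_addHaar volume (f := fun r : ℝ => (‖w‖ * r) ^ k * Real.exp (-r ^ 2))]
    refine ((integrableOn_pow_mul_exp_neg_sq (Module.finrank ℝ V - 1 + k)).const_mul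
      (‖w‖ ^ k)).congr (Eventually.of_forall fun r => ?_)
    simp only [smul_eq_mul]
    ring
  refine h1.mono (by fun_prop) (Eventually.of_forall fun x => ?_)
  simp only [norm_mul, norm_pow, Real.norm_eq_abs, Real.abs_exp, abs_norm]
  gcongr
  exact abs_real_inner_le_norm w x

/-- Gaussian moments in terms of spherical moments. -/
lemma integral_inner_pow_mul_exp_neg_norm_sq [Nontrivial V] (w : V) (k : ℕ) :
    ∫ x : V, ⟪w, x⟫ ^ (2 * k) * Real.exp (-‖x‖ ^ 2) =
      Real.Gamma (k + Module.finrank ℝ V / 2) / 2 *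
        ∫ ω : Metric.sphere (0 : V) 1, ⟪w, (ω : V)⟫ ^ (2 * k) ∂(volume : Measure V).toSphere := by
  rw [integral_eq_integral_toSphere volume (integrable_inner_pow_mul_exp_neg_norm_sq w (2 * k))]
  have hd : 0 < Module.finrank ℝ V := Module.finrank_pos
  have h2 := integral_Ioi_pow_mul_exp_neg_sq (Module.finrank ℝ V - 1 + 2 * k)
  have e : (((Module.finrank ℝ V - 1 + 2 * k : ℕ) : ℝ) + 1) / 2 = k + Module.finrank ℝ V / 2 := by
    rw [Nat.cast_add, Nat.cast_sub hd]; push_cast; ring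
  rw [← e, ← h2, ← integral_mul_const]
  refine setIntegral_congr_fun measurableSet_Ioi fun r hr => ?_
  have hr' : (0 : ℝ) ≤ r := le_of_lt hr
  have : ∀ ω : Metric.sphere (0 : V) 1,
      ⟪w, r • (ω : V)⟫ ^ (2 * k) * Real.exp (-‖r • (ω : V)‖ ^ 2)
        = (r ^ (2 * k) * Real.exp (-r ^ 2)) * ⟪w, (ω : V)⟫ ^ (2 * k) := by
    intro ω
    rw [inner_smul_right, norm_smul, norm_eq_of_mem_sphere, Real.norm_of_nonneg hr']
    ring_nf
  simp_rw [this, integral_const_mul]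
  ring

lemma hasSum_integral_sphere_cos_inner (w : V) :
    HasSum (fun k : ℕ => (-1 : ℝ) ^ k / ((2 * k).factorial : ℝ) *
        ∫ ω : Metric.sphere (0 : V) 1, ⟪w, (ω : V)⟫ ^ (2 * k) ∂(volume : Measure V).toSphere)
      (∫ ω : Metric.sphere (0 : V) 1, Real.cos ⟪w, (ω : V)⟫ ∂(volume : Measure V).toSphere) := by
  set σ := (volume : Measure V).toSphere
  have hb : ∀ (k : ℕ) (ω : Metric.sphere (0 : V) 1),
      ‖(-1 : ℝ) ^ k * ⟪w, (ω : V)⟫ ^ (2 * k) / ((2 * k).factorial : ℝ)‖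
        ≤ ‖w‖ ^ (2 * k) / ((2 * k).factorial : ℝ) := by
    intro k ω
    have h := abs_real_inner_le_norm w (ω : V)
    rw [norm_eq_of_mem_sphere, mul_one] at h
    simp only [norm_div, norm_mul, norm_pow, Real.norm_eq_abs, abs_neg, abs_one, one_pow, one_mul,
      Nat.abs_cast]
    gcongr
  have hcont : ∀ k : ℕ, Continuous fun ω : Metric.sphere (0 : V) 1 =>
      (-1 : ℝ) ^ k * ⟪w, (ω : V)⟫ ^ (2 * k) / ((2 * k).factorial : ℝ) := fun k => by fun_prop
  have hint : ∀ k : ℕ, Integrable (fun ω : Metric.sphere (0 : V) 1 =>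
      (-1 : ℝ) ^ k * ⟪w, (ω : V)⟫ ^ (2 * k) / ((2 * k).factorial : ℝ)) σ := fun k =>
    Integrable.of_bound (hcont k).aestronglyMeasurable _ (Eventually.of_forall (hb k))
  have hsum : Summable fun k : ℕ => ‖w‖ ^ (2 * k) / ((2 * k).factorial : ℝ) :=
    (Real.summable_pow_div_factorial ‖w‖).comp_injective (mul_right_injective₀ two_ne_zero)
  have h := hasSum_integral_of_summable_integral_norm hint (by
    refine Summable.of_nonneg_of_le (fun k => integral_nonneg fun ω => norm_nonneg _) (fun k => ?_)
      (hsum.mul_right (σ.real Set.univ))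
    refine (integral_mono (hint k).norm (integrable_const _) (hb k)).trans ?_
    simp [mul_comm])
  simp_rw [← Real.cos_eq_tsum] at h
  convert! h using 2 with k
  rw [← integral_const_mul]
  congr 1; ext ω; ring
end

/-- The Gaussian factorises over the coordinates. Compared with the polar evaluation of the same
moment, this determines the spherical moments. -/
lemma integral_coord_pow_mul_exp_neg_norm_sq (n : ℕ) (s : ℝ) (k : ℕ) :
    ∫ x : EuclideanSpace ℝ (Fin (n + 1)),
      ⟪s • EuclideanSpace.single (0 : Fin (n + 1)) (1 : ℝ), x⟫ ^ (2 * k) * Real.exp (-‖x‖ ^ 2)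
      = s ^ (2 * k) * (Real.Gamma (k + 1 / 2) * √Real.pi ^ n) := by
  have hmp := EuclideanSpace.volume_preserving_symm_measurableEquiv_toLp (Fin (n + 1))
  have hprod := integral_fintype_prod_volume_eq_prod (𝕜 := ℝ) (ι := Fin (n + 1))
    (E := fun _ => ℝ) (fun i t => (if i = 0 then t ^ (2 * k) else 1) * Real.exp (-t ^ 2))
  rw [Fin.prod_univ_succ] at hprod
  have hg : ∫ t : ℝ, Real.exp (-t ^ 2) = √Real.pi := by
    simpa using integral_gaussian 1
  simp only [if_true, Fin.succ_ne_zero, if_false, one_mul, hg,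
    integral_pow_two_mul_mul_exp_neg_sq] at hprod
  rw [Finset.prod_const, Finset.card_univ, Fintype.card_fin] at hprod
  rw [← hprod, ← hmp.integral_comp (MeasurableEquiv.measurableEmbedding _),
    ← integral_const_mul]
  congr 1; ext x
  rw [Finset.prod_mul_distrib, ← Real.exp_sum]
  simp [inner_smul_left, EuclideanSpace.inner_single_left, EuclideanSpace.norm_sq_eq, mul_pow,
    mul_assoc]

/-- Inserting the spherical moments into the cosine series gives the Bessel series term by term: the
`(2k)!` in `Γ(k + 1/2)` cancels the one in the cosine coefficients. -/
lemma integral_sphere_cos_single (n : ℕ) {s : ℝ} (hs : 0 < s) :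
    ∫ ω : Metric.sphere (0 : EuclideanSpace ℝ (Fin (n + 1))) 1,
      Real.cos ⟪s • EuclideanSpace.single (0 : Fin (n + 1)) (1 : ℝ),
        (ω : EuclideanSpace ℝ (Fin (n + 1)))⟫
        ∂(volume : Measure (EuclideanSpace ℝ (Fin (n + 1)))).toSphere
      = (2 * Real.pi) ^ (((n + 1 : ℕ) : ℝ) / 2) * besselj (((n + 1 : ℕ) : ℝ) / 2 - 1) s := by
  rw [← (hasSum_integral_sphere_cos_inner _).tsum_eq, besselj, besselJ, ← tsum_div_const,
    ← tsum_mul_left]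
  congr 1; ext k
  have h := integral_inner_pow_mul_exp_neg_norm_sq
    (s • EuclideanSpace.single (0 : Fin (n + 1)) (1 : ℝ)) k
  rw [integral_coord_pow_mul_exp_neg_norm_sq, finrank_euclideanSpace_fin,
    Gamma_nat_add_half_eq_factorial] at h
  set M := ∫ ω : Metric.sphere (0 : EuclideanSpace ℝ (Fin (n + 1))) 1,
    ⟪s • EuclideanSpace.single (0 : Fin (n + 1)) (1 : ℝ),
        (ω : EuclideanSpace ℝ (Fin (n + 1)))⟫ ^ (2 * k)
        ∂(volume : Measure (EuclideanSpace ℝ (Fin (n + 1)))).toSphere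
  set ν : ℝ := ((n + 1 : ℕ) : ℝ) / 2 with hν
  have hΓ : 0 < Real.Gamma (k + ν) := Real.Gamma_pos_of_pos (by positivity)
  rw [show (k : ℝ) + (ν - 1) + 1 = k + ν by ring]
  have e1 : (s / 2) ^ (2 * (k : ℝ) + (ν - 1)) / s ^ (ν - 1)
      = s ^ (2 * k) / 4 ^ k * (2 * 2 ^ (-ν)) := by
    rw [Real.rpow_add (by positivity), Real.div_rpow hs.le zero_le_two (ν - 1),
      show (2 : ℝ) * k = ((2 * k : ℕ) : ℝ) by push_cast; ring, Real.rpow_natCast, div_pow,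
      pow_mul 2, Real.rpow_sub_one two_ne_zero ν, Real.rpow_neg two_pos.le]
    have := Real.rpow_pos_of_pos hs (ν - 1)
    field_simp
    norm_num
  have e2 : (2 * Real.pi) ^ ν * 2 ^ (-ν) = √Real.pi ^ (n + 1) := by
    rw [Real.mul_rpow two_pos.le Real.pi_pos.le, Real.rpow_neg two_pos.le, Real.sqrt_eq_rpow,
      ← Real.rpow_natCast, ← Real.rpow_mul Real.pi_pos.le, hν,
      show (1 / 2 : ℝ) * ((n + 1 : ℕ) : ℝ) = ((n + 1 : ℕ) : ℝ) / 2 by ring]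
    have := Real.rpow_pos_of_pos two_pos (((n + 1 : ℕ) : ℝ) / 2)
    field_simp
  have e3 : M = 2 * s ^ (2 * k) * ((2 * k).factorial * √Real.pi ^ (n + 1) /
      (4 ^ k * k.factorial)) / Real.Gamma (k + ν) := by
    field_simp
    rw [pow_succ]
    field_simp at h
    linarith
  rw [mul_div_assoc, e1, e3, ← e2]
  field_simp

/-! ### Cosine transforms of radial functions -/

section
variable {V : Type*} [NormedAddCommGroup V] [InnerProductSpace ℝ V]
  [FiniteDimensional ℝ V] [MeasurableSpace V] [BorelSpace V]

lemma MeasureTheory.Integrable.mul_cos_inner {f : V → ℝ} (hf : Integrable f) (w : V) :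
    Integrable (fun x => f x * Real.cos ⟪w, x⟫) :=
  hf.mul_bdd (c := 1) (by fun_prop) (Eventually.of_forall fun x => Real.abs_cos_le_one _)

/-- The reflection exchanging `v` and `w` preserves norms and volume. -/
lemma integral_norm_mul_cos_inner_eq_of_norm_eq (f : ℝ → ℝ) {v w : V} (h : ‖v‖ = ‖w‖) :
    ∫ x : V, f ‖x‖ * Real.cos ⟪v, x⟫ = ∫ x : V, f ‖x‖ * Real.cos ⟪w, x⟫ := by
  set R := (ℝ ∙ (v - w))ᗮ.reflection
  have hR : R v = w := Submodule.reflection_sub h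
  rw [← R.measurePreserving.integral_comp R.toHomeomorph.measurableEmbedding
    (fun x => f ‖x‖ * Real.cos ⟪w, x⟫)]
  congr 1; ext x
  rw [← hR, R.inner_map_map, R.norm_map]

open scoped FourierTransform in
/-- The Fourier transform of an even real function is its cosine transform. -/
lemma fourier_ofReal_of_even {f : V → ℝ} (hf : Integrable f) (heven : ∀ x, f (-x) = f x) (w : V) :
    𝓕 (fun x => (f x : ℂ)) w = ((∫ x, f x * Real.cos ⟪(2 * Real.pi) • w, x⟫ : ℝ) : ℂ) := by
  have hint : Integrable (fun v => 𝐞 (-⟪v, w⟫) • (f v : ℂ)) :=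
    (Real.fourierIntegral_convergent_iff w).2 hf.ofReal
  have h1 : 𝓕 (fun x => (f x : ℂ)) w = ∫ v, 𝐞 (-⟪v, w⟫) • (f v : ℂ) := Real.fourier_eq _ _
  have h2 : 𝓕 (fun x => (f x : ℂ)) w = ∫ v, 𝐞 (-⟪-v, w⟫) • (f (-v) : ℂ) := by
    rw [h1, integral_neg_eq_self (fun v => 𝐞 (-⟪v, w⟫) • (f v : ℂ))]
  have h3 : 𝓕 (fun x => (f x : ℂ)) w + 𝓕 (fun x => (f x : ℂ)) w
      = ∫ v, ((2 * (f v * Real.cos ⟪(2 * Real.pi) • w, v⟫) : ℝ) : ℂ) := by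
    nth_rewrite 1 [h1]
    rw [h2, ← integral_add hint hint.comp_neg]
    congr 1; ext v
    simp only [Circle.smul_def, Real.fourierChar_apply, heven, smul_eq_mul, ← add_mul,
      inner_neg_left, neg_neg, inner_smul_left, real_inner_comm]
    push_cast
    rw [Complex.cos]
    simp only [RCLike.conj_to_real]
    push_cast
    ring_nf
  rw [integral_complex_ofReal, integral_const_mul] at h3
  push_cast at h3
  rw [← two_mul] at h3
  exact mul_left_cancel₀ two_ne_zero h3

open scoped FourierTransform in
-- The transform is continuous, so vanishing off the origin makes it zero everywhere; it is then
-- integrable and Fourier inversion applies.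
lemma eq_zero_of_integral_mul_cos_inner_eq_zero {f : V → ℝ} (hc : Continuous f)
    (hf : Integrable f) (heven : ∀ x, f (-x) = f x) [Nontrivial V]
    (h : ∀ w ≠ 0, ∫ x, f x * Real.cos ⟪w, x⟫ = 0) : f = 0 := by
  set F : V → ℂ := fun x => (f x : ℂ)
  have hne : ∀ w : V, w ≠ 0 → 𝓕 F w = 0 := by
    intro w hw
    rw [fourier_ofReal_of_even hf heven, h _ (smul_ne_zero (by positivity) hw), Complex.ofReal_zero]
  have hFc : Continuous (𝓕 F) := VectorFourier.fourierIntegral_continuous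
    Real.continuous_fourierChar (by exact continuous_inner) hf.ofReal
  have hzero : 𝓕 F = 0 :=
    hFc.ext_on (dense_compl_singleton (0 : V)) continuous_const fun w hw => hne w hw
  have hinv : 𝓕⁻ (𝓕 F) = F :=
    Continuous.fourierInv_fourier_eq (by fun_prop) hf.ofReal
      (by rw [hzero]; exact integrable_zero _ _ _)
  ext v
  have := congrFun hinv v
  rw [hzero, Real.fourierInv_eq] at this
  simpa [F] using this.symm

/-- Riemann–Lebesgue, with the frequency rescaled by `2π`. -/
lemma tendsto_integral_mul_cos_inner {f : V → ℝ} (hf : Integrable f)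
    (heven : ∀ x, f (-x) = f x) {e : V} (he : e ≠ 0) :
    Tendsto (fun s : ℝ => ∫ x, f x * Real.cos ⟪s • e, x⟫) atTop (𝓝 0) := by
  have h1 := tendsto_integral_exp_inner_smul_cocompact (V := V) (fun x => (f x : ℂ))
  have h2 : Tendsto (fun s : ℝ => (s / (2 * Real.pi)) • e) atTop (cocompact V) := by
    rw [← Metric.cobounded_eq_cocompact, ← tendsto_norm_atTop_iff_cobounded]
    simp only [norm_smul]
    exact (tendsto_norm_atTop_atTop.comp
      (tendsto_id.atTop_div_const (by positivity))).atTop_mul_const (norm_pos_iff.2 he)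
  have h3 := (Complex.continuous_re.tendsto _).comp (h1.comp h2)
  refine h3.congr fun s => ?_
  simp only [Function.comp]
  rw [← Real.fourier_eq, fourier_ofReal_of_even hf heven, Complex.ofReal_re, smul_smul,
    mul_div_cancel₀ _ (by positivity)]
end

lemma integrable_norm_sq {φ : ℝ → ℝ} {n : ℕ} (hφ : ContinuousOn φ (Set.Ici 0))
    (hi : IntegrableOn (fun u : ℝ => |φ (u ^ 2)| * u ^ n) (Set.Ioi 0)) :
    Integrable (fun x : EuclideanSpace ℝ (Fin (n + 1)) => φ (‖x‖ ^ 2)) := by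
  have hc : Continuous fun u : ℝ => φ (u ^ 2) :=
    hφ.comp_continuous (by fun_prop) fun u => sq_nonneg u
  rw [integrable_fun_norm_addHaar volume (f := fun u : ℝ => φ (u ^ 2)),
    finrank_euclideanSpace_fin]
  refine Integrable.mono hi ((continuous_pow _).smul hc).aestronglyMeasurable
    ((ae_restrict_mem measurableSet_Ioi).mono fun u hu => ?_)
  simp [abs_of_pos (show (0 : ℝ) < u from hu), mul_comm]

/-- The Fourier transform of a radial function as a Bessel integral. -/
lemma integral_norm_sq_mul_cos_inner {φ : ℝ → ℝ} {n : ℕ}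
    (hi : Integrable (fun x : EuclideanSpace ℝ (Fin (n + 1)) => φ (‖x‖ ^ 2)))
    {w : EuclideanSpace ℝ (Fin (n + 1))} (hw : w ≠ 0) :
    ∫ x : EuclideanSpace ℝ (Fin (n + 1)), φ (‖x‖ ^ 2) * Real.cos ⟪w, x⟫
      = (2 * Real.pi) ^ (((n + 1 : ℕ) : ℝ) / 2) * besselIntegral φ (n + 1) ‖w‖ := by
  have hs : 0 < ‖w‖ := norm_pos_iff.2 hw
  set e : EuclideanSpace ℝ (Fin (n + 1)) := EuclideanSpace.single (0 : Fin (n + 1)) (1 : ℝ) with he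
  have hne : ‖w‖ = ‖‖w‖ • e‖ := by simp [norm_smul, he]
  rw [integral_norm_mul_cos_inner_eq_of_norm_eq (fun r => φ (r ^ 2)) hne,
    integral_eq_integral_toSphere volume (hi.mul_cos_inner _), besselIntegral,
    ← integral_const_mul, finrank_euclideanSpace_fin]
  refine setIntegral_congr_fun measurableSet_Ioi fun r hr => ?_
  have hr' : 0 < r := hr
  have h1 : ∀ ω : Metric.sphere (0 : EuclideanSpace ℝ (Fin (n + 1))) 1,
      φ (‖r • (ω : EuclideanSpace ℝ (Fin (n + 1)))‖ ^ 2) *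
        Real.cos ⟪‖w‖ • e, r • (ω : EuclideanSpace ℝ (Fin (n + 1)))⟫
      = φ (r ^ 2) * Real.cos ⟪(‖w‖ * r) • e, (ω : EuclideanSpace ℝ (Fin (n + 1)))⟫ := by
    intro ω
    rw [norm_smul, norm_eq_of_mem_sphere, Real.norm_of_nonneg hr'.le, mul_one, inner_smul_right,
      mul_comm ‖w‖ r, mul_smul, inner_smul_left _ _ r]
    rfl
  simp_rw [h1, integral_const_mul]
  rw [integral_sphere_cos_single n (mul_pos hs hr')]
  ring

lemma integrable_norm_sq_div {φ : ℝ → ℝ} {V : Type*} [NormedAddCommGroup V] [InnerProductSpace ℝ V]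
    [FiniteDimensional ℝ V] [MeasurableSpace V] [BorelSpace V]
    (hi : Integrable (fun x : V => φ (‖x‖ ^ 2))) {H : ℝ} (hH : 0 < H) :
    Integrable (fun x : V => φ (‖x‖ ^ 2 / H)) := by
  have h := hi.comp_smul (R := (√H)⁻¹) (by positivity)
  refine h.congr (Eventually.of_forall fun x => ?_)
  simp only [norm_smul, norm_inv, Real.norm_of_nonneg (Real.sqrt_nonneg H), mul_pow, inv_pow,
    Real.sq_sqrt hH.le]
  rw [div_eq_inv_mul]

lemma integral_norm_sq_div_mul_cos_inner {φ : ℝ → ℝ} {n : ℕ}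
    (hi : Integrable (fun x : EuclideanSpace ℝ (Fin (n + 1)) => φ (‖x‖ ^ 2)))
    {w : EuclideanSpace ℝ (Fin (n + 1))} (hw : w ≠ 0) {H : ℝ} (hH : 0 < H) :
    ∫ x : EuclideanSpace ℝ (Fin (n + 1)), φ (‖x‖ ^ 2 / H) * Real.cos ⟪w, x⟫
      = √H ^ (n + 1) * ((2 * Real.pi) ^ (((n + 1 : ℕ) : ℝ) / 2) *
        besselIntegral φ (n + 1) (√H * ‖w‖)) := by
  have hs : 0 < √H := Real.sqrt_pos.2 hH
  have h1 := integral_norm_sq_mul_cos_inner hi (smul_ne_zero hs.ne' hw)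
  rw [norm_smul, Real.norm_of_nonneg hs.le] at h1
  rw [← h1]
  have h2 := Measure.integral_comp_smul (volume : Measure (EuclideanSpace ℝ (Fin (n + 1))))
    (fun x => φ (‖x‖ ^ 2) * Real.cos ⟪√H • w, x⟫) (√H)⁻¹
  rw [finrank_euclideanSpace_fin, inv_pow, inv_inv, abs_of_pos (by positivity), smul_eq_mul] at h2
  rw [← h2]
  congr 1; ext x
  rw [norm_smul, norm_inv, Real.norm_of_nonneg hs.le, mul_pow, inv_pow, Real.sq_sqrt hH.le,
    real_inner_smul_left, real_inner_smul_right, mul_inv_cancel_left₀ hs.ne', div_eq_inv_mul]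

/-! ### Inequalities for positive definite functions -/

namespace IsPositiveDefiniteFun
variable {F : Type*} [AddCommGroup F]

lemma sum_nonneg {f : F → ℂ} (hf : IsPositiveDefiniteFun f) {ι : Type*} [Fintype ι]
    (ξ : ι → F) (a : ι → ℂ) :
    0 ≤ (∑ i, ∑ j, a i * f (ξ i - ξ j) * (starRingEnd ℂ) (a j)).re := by
  have h := (hf (Fintype.card ι) (ξ ∘ (Fintype.equivFin ι).symm)
    (a ∘ (Fintype.equivFin ι).symm)).1
  simp only [Function.comp] at h
  rw [(Fintype.equivFin ι).symm.sum_comp (fun i => ∑ j, a i *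
    f (ξ i - ξ ((Fintype.equivFin ι).symm j)) *
      (starRingEnd ℂ) (a ((Fintype.equivFin ι).symm j)))] at h
  convert! h using 3 with i
  exact ((Fintype.equivFin ι).symm.sum_comp (fun j => a i *
    f (ξ i - ξ j) * (starRingEnd ℂ) (a j))).symm

variable {r : F → ℝ}

lemma real_even (hr : IsPositiveDefiniteFun fun x => (r x : ℂ)) (x : F) : r (-x) = r x := by
  -- The imaginary part for the weights `1, i` is `r (-x) - r x`.
  have h := (hr 2 ![x, 0] ![1, Complex.I]).2
  simp [Fin.sum_univ_two] at h
  linarith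

lemma abs_le_apply_zero (hr : IsPositiveDefiniteFun fun x => (r x : ℂ)) (x : F) :
    |r x| ≤ r 0 := by
  have h1 := (hr 2 ![x, 0] ![1, 1]).1
  have h2 := (hr 2 ![x, 0] ![1, -1]).1
  simp [Fin.sum_univ_two, hr.real_even] at h1 h2
  rw [abs_le]
  constructor <;> linarith

/-- For a real positive definite `r` on `V × T`, even in the second variable at `t`, and `ε = ±1`,
the function `(r (·, 0) + ε r (·, t)) cos ⟪w, ·⟫` is positive definite. -/
lemma sum_cos_nonneg {V T : Type*} [NormedAddCommGroup V] [InnerProductSpace ℝ V] [AddCommGroup T]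
    {r : V × T → ℝ} (hr : IsPositiveDefiniteFun fun p => (r p : ℂ))
    {t : T} (ht : ∀ x, r (x, -t) = r (x, t)) (w : V) {ε : ℝ} (hε : ε ^ 2 = 1)
    (n : ℕ) (x : Fin n → V) :
    0 ≤ ∑ i, ∑ j, (r (x i - x j, 0) + ε * r (x i - x j, t)) * Real.cos ⟪w, x i - x j⟫ := by
  -- Take both `(x i, 0)` and `(x i, t)`, the latter with an extra weight `ε`. As `ε² = 1` and `r`
  -- is even at `t`, the four blocks add up to twice the desired sum.
  have h := hr.sum_nonneg (ι := Fin n × Bool) (fun p => (x p.1, if p.2 then t else 0))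
    (fun p => Complex.exp (-(⟪w, x p.1⟫ : ℝ) * Complex.I) * (if p.2 then (ε : ℂ) else 1))
  simp only [Fintype.sum_prod_type, Fintype.sum_bool] at h
  have hterm : ∀ i j : Fin n, (Complex.exp (-(⟪w, x i⟫ : ℝ) * Complex.I) *
      (starRingEnd ℂ) (Complex.exp (-(⟪w, x j⟫ : ℝ) * Complex.I))).re =
      Real.cos ⟪w, x i - x j⟫ := by
    intro i j
    rw [← Complex.exp_conj, ← Complex.exp_add, inner_sub_right, ← Real.cos_neg,
      ← Complex.exp_ofReal_mul_I_re]
    congr 2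
    simp
    ring
  have e : ∀ i j : Fin n, (r (x i - x j, 0) + ε * r (x i - x j, t)) * Real.cos ⟪w, x i - x j⟫
      = ((Complex.exp (-(⟪w, x i⟫ : ℝ) * Complex.I) *
      (starRingEnd ℂ) (Complex.exp (-(⟪w, x j⟫ : ℝ) * Complex.I))) *
        ((r (x i - x j, 0) + ε * r (x i - x j, t) : ℝ) : ℂ)).re := by
    intro i j
    rw [Complex.re_mul_ofReal, hterm, mul_comm]
  simp_rw [e, ← Complex.re_sum]
  have h2 : (0 : ℝ) ≤ (2 * ∑ i, ∑ j, (Complex.exp (-(⟪w, x i⟫ : ℝ) * Complex.I) *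
      (starRingEnd ℂ) (Complex.exp (-(⟪w, x j⟫ : ℝ) * Complex.I))) *
        ((r (x i - x j, 0) + ε * r (x i - x j, t) : ℝ) : ℂ)).re := by
    convert! h using 2
    rw [Finset.mul_sum]
    refine Finset.sum_congr rfl fun i _ => ?_
    rw [Finset.mul_sum, ← Finset.sum_add_distrib]
    refine Finset.sum_congr rfl fun j _ => ?_
    have hε' : (ε : ℂ) ^ 2 = 1 := by exact_mod_cast hε
    simp only [if_true, Bool.false_eq_true, if_false, Prod.mk_sub_mk, sub_self, zero_sub, sub_zero,
      ht, map_mul, Complex.conj_ofReal, mul_one]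
    push_cast
    linear_combination (-(r (x i - x j, 0) : ℂ)) * (Complex.exp (-(⟪w, x i⟫ : ℝ) * Complex.I) *
      (starRingEnd ℂ) (Complex.exp (-(⟪w, x j⟫ : ℝ) * Complex.I))) * hε'
  rw [show (2 : ℂ) = ((2 : ℝ) : ℂ) by norm_num, Complex.re_ofReal_mul] at h2
  linarith

lemma comp_addMonoidHom {F' : Type*} [AddCommGroup F'] {f : F → ℂ} (hf : IsPositiveDefiniteFun f)
    (A : F' →+ F) : IsPositiveDefiniteFun fun x => f (A x) := by
  intro n ξ a
  simpa using hf n (fun i => A (ξ i)) a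

end IsPositiveDefiniteFun

/-! ### Rays, dilations and analytic rigidity -/

lemma IsFinitelyContinuous.continuous_smul_right {E : Type*} [AddCommGroup E] [Module ℝ E]
    {h : E → ℝ} (hh : IsFinitelyContinuous h) (t : E) : Continuous fun r : ℝ => h (r • t) := by
  by_cases ht : t = 0
  · simp [ht, continuous_const]
  have h1 := hh (ℝ ∙ t) 1
    ((Module.Basis.singleton (Fin 1) ℝ).map (LinearEquiv.toSpanNonzeroSingleton ℝ E t ht))
  have h2 := h1.comp (continuous_pi fun _ => continuous_id :
    Continuous fun (r : ℝ) (_ : Fin 1) => r)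
  refine h2.congr fun r => ?_
  simp

/-- For large `n` the root `(b / a) ^ (1 / n)` lies in `[1, q₀]`, so `b` is reached from `a` by `n`
admissible dilations. -/
lemma antitoneOn_Ioi_of_dilation {G : ℝ → ℝ} {q₀ : ℝ} (hq₀ : 1 < q₀)
    (h : ∀ s, 0 < s → ∀ q ∈ Set.Icc 1 q₀, G (s * q) ≤ G s) : AntitoneOn G (Set.Ioi 0) := by
  have hpow : ∀ (n : ℕ) (s : ℝ), 0 < s → ∀ q ∈ Set.Icc 1 q₀, G (s * q ^ n) ≤ G s := by
    intro n
    induction n with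
    | zero => intro s _ q _; simp
    | succ n ih =>
      intro s hs q hq
      have hq0 : 0 < q := lt_of_lt_of_le one_pos hq.1
      rw [pow_succ, ← mul_assoc]
      exact (h _ (by positivity) q hq).trans (ih s hs q hq)
  intro a ha b hb hab
  have ha' : 0 < a := ha
  have hba : 1 ≤ b / a := (one_le_div ha').2 hab
  obtain ⟨n, hn⟩ := pow_unbounded_of_one_lt (b / a) hq₀
  have hn0 : n ≠ 0 := by
    rintro rfl
    simp at hn
    linarith
  have hroot : ((b / a) ^ ((n : ℝ)⁻¹)) ^ n = b / a :=
    Real.rpow_inv_natCast_pow (by positivity) hn0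
  have := hpow n a ha' ((b / a) ^ ((n : ℝ)⁻¹)) ⟨Real.one_le_rpow hba (by positivity), by
    refine le_of_pow_le_pow_left₀ hn0 (by linarith) ?_
    rw [hroot]; exact hn.le⟩
  rwa [hroot, mul_div_cancel₀ _ ha'.ne'] at this

/-- If `G a = G b` with `a < b`, monotonicity makes `G` constant on `[a, b]`, and the identity
theorem extends this to the half-line. -/
lemma strictAntiOn_or_eqOn_const_of_analytic {G : ℝ → ℝ} (hG : AntitoneOn G (Set.Ioi 0))
    (ha : AnalyticOnNhd ℝ G (Set.Ioi 0)) :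
    StrictAntiOn G (Set.Ioi 0) ∨ ∃ c, ∀ s, 0 < s → G s = c := by
  by_contra hcon
  push Not at hcon
  obtain ⟨h1, h2⟩ := hcon
  refine h1 fun a ha' b hb hab => lt_of_le_of_ne (hG ha' hb hab.le) fun hEq => ?_
  obtain ⟨s, hs, hne⟩ := h2 (G a)
  refine hne ?_
  have ha0 : 0 < a := ha'
  have hmid : (a + b) / 2 ∈ Set.Ioo a b := ⟨by linarith, by linarith⟩
  have hev : G =ᶠ[𝓝 ((a + b) / 2)] fun _ => G a := by
    filter_upwards [Ioo_mem_nhds hmid.1 hmid.2] with x hx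
    have hx0 : x ∈ Set.Ioi (0 : ℝ) := ha0.trans hx.1
    exact le_antisymm (hG ha' hx0 hx.1.le) (hEq ▸ hG hx0 hb hx.2.le)
  exact ha.eqOn_of_preconnected_of_eventuallyEq analyticOnNhd_const isPreconnected_Ioi
    (show (a + b) / 2 ∈ Set.Ioi (0 : ℝ) from ha0.trans hmid.1) hev hs

/-- `√H ^ m * H ^ (-d/2) = √H ^ (m - d)`. -/
lemma rpow_neg_half_mul_sqrt_pow {H : ℝ} (hH : 0 < H) (d m : ℕ) :
    H ^ (-(d : ℝ) / 2) * √H ^ m = √H ^ ((m : ℤ) - (d : ℤ)) := by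
  have hs : 0 < √H := Real.sqrt_pos.2 hH
  have h1 : H ^ (-(d : ℝ) / 2) = √H ^ (-(d : ℤ)) := by
    rw [← Real.rpow_intCast, Real.sqrt_eq_rpow, ← Real.rpow_mul hH.le]
    congr 1
    push_cast
    ring
  rw [h1, ← zpow_natCast, ← zpow_add₀ hs.ne']
  congr 1
  ring

lemma exists_linearIsometry_euclideanSpace {m d : ℕ} (h : m ≤ d) :
    Nonempty (EuclideanSpace ℝ (Fin m) →ₗᵢ[ℝ] EuclideanSpace ℝ (Fin d)) := by
  let b := EuclideanSpace.basisFun (Fin m) ℝ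
  let b' := EuclideanSpace.basisFun (Fin d) ℝ
  let f : EuclideanSpace ℝ (Fin m) →ₗ[ℝ] EuclideanSpace ℝ (Fin d) :=
    b.toBasis.constr ℝ (b' ∘ Fin.castLE h)
  refine ⟨f.isometryOfOrthonormal (v := b.toBasis) (by simp) ?_⟩
  have : f ∘ b.toBasis = b' ∘ Fin.castLE h := by
    ext1 i
    exact b.toBasis.constr_basis ℝ _ i
  rw [this]
  exact b'.orthonormal.comp _ (Fin.castLE_injective h)

/-! ### The dilation inequality for the Bessel integral -/

section
variable {E : Type*} [AddCommGroup E] {d : ℕ} {h : E → ℝ} {φ : ℝ → ℝ}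

/-- At `x = 0` the kernel is `h t ^ (-d/2) * φ 0`, which must be even and, for the next lemma,
maximal at `t = 0`; the exponent is negative. -/
lemma neg_eq_of_isPositiveDefiniteFun (hd : d ≠ 0) (h_pos : ∀ t, 0 < h t) (φ_zero : 0 < φ 0)
    (hK : IsPositiveDefiniteFun (fun p : EuclideanSpace ℝ (Fin d) × E =>
      (((h p.2) ^ (-(d : ℝ) / 2) * φ (‖p.1‖ ^ 2 / h p.2) : ℝ) : ℂ))) (t : E) : h (-t) = h t := by
  have h1 := hK.real_even (0, t)
  simp only [Prod.neg_mk, neg_zero, norm_zero, ne_eq, OfNat.ofNat_ne_zero, not_false_eq_true,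
    zero_pow, zero_div] at h1
  have hd' : (d : ℝ) ≠ 0 := by exact_mod_cast hd
  exact (Real.rpow_left_inj (h_pos _).le (h_pos _).le (by simpa using hd')).1
    (mul_right_cancel₀ φ_zero.ne' h1)

lemma zero_le_of_isPositiveDefiniteFun (hd : d ≠ 0) (h_pos : ∀ t, 0 < h t) (φ_zero : 0 < φ 0)
    (hK : IsPositiveDefiniteFun (fun p : EuclideanSpace ℝ (Fin d) × E =>
      (((h p.2) ^ (-(d : ℝ) / 2) * φ (‖p.1‖ ^ 2 / h p.2) : ℝ) : ℂ))) (t : E) : h 0 ≤ h t := by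
  have h1 := (le_abs_self _).trans (hK.abs_le_apply_zero (0, t))
  simp only [Prod.fst_zero, Prod.snd_zero, norm_zero, ne_eq, OfNat.ofNat_ne_zero,
    not_false_eq_true, zero_pow, zero_div] at h1
  have hd' : (0 : ℝ) < d := by exact_mod_cast Nat.pos_of_ne_zero hd
  exact (Real.rpow_le_rpow_iff_of_neg (h_pos _) (h_pos _) (by linarith)).1
    (le_of_mul_le_mul_right h1 φ_zero)

/-- For `ε = ±1` the function `(r (·, 0) + ε r (·, t)) cos ⟪w, ·⟫` has nonnegative integral; the two
signs together give the absolute value. -/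
lemma abs_besselIntegral_sqrt_le {n : ℕ} (hnd : n + 1 ≤ d) (h_pos : ∀ t, 0 < h t)
    (φ_cont : ContinuousOn φ (Set.Ici 0)) (φ_zero : 0 < φ 0)
    (hK : IsPositiveDefiniteFun (fun p : EuclideanSpace ℝ (Fin d) × E =>
      (((h p.2) ^ (-(d : ℝ) / 2) * φ (‖p.1‖ ^ 2 / h p.2) : ℝ) : ℂ)))
    (hi : Integrable (fun x : EuclideanSpace ℝ (Fin (n + 1)) => φ (‖x‖ ^ 2)))
    (t : E) {s : ℝ} (hs : 0 < s) :
    |√(h t) ^ (((n + 1 : ℕ) : ℤ) - (d : ℤ)) * besselIntegral φ (n + 1) (√(h t) * s)| ≤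
      √(h 0) ^ (((n + 1 : ℕ) : ℤ) - (d : ℤ)) * besselIntegral φ (n + 1) (√(h 0) * s) := by
  obtain ⟨A⟩ := exists_linearIsometry_euclideanSpace hnd
  obtain ⟨w, hwn⟩ : ∃ w : EuclideanSpace ℝ (Fin (n + 1)), ‖w‖ = s :=
    ⟨s • EuclideanSpace.single (0 : Fin (n + 1)) (1 : ℝ), by simp [norm_smul, abs_of_pos hs]⟩
  set r : EuclideanSpace ℝ (Fin (n + 1)) × E → ℝ :=
    fun p => h p.2 ^ (-(d : ℝ) / 2) * φ (‖p.1‖ ^ 2 / h p.2) with hrdef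
  have hr : IsPositiveDefiniteFun fun p => (r p : ℂ) := by
    have := hK.comp_addMonoidHom
      ((A.toLinearMap.toAddMonoidHom).prodMap (AddMonoidHom.id E))
    simpa [hrdef] using this
  have ht := neg_eq_of_isPositiveDefiniteFun (by omega) h_pos φ_zero hK t
  have hcont : ∀ t, Continuous fun x : EuclideanSpace ℝ (Fin (n + 1)) => r (x, t) := fun t =>
    (continuous_const (y := h t ^ (-(d : ℝ) / 2))).mul (φ_cont.comp_continuous
      (f := fun x : EuclideanSpace ℝ (Fin (n + 1)) => ‖x‖ ^ 2 / h t) (by fun_prop)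
      fun x => div_nonneg (sq_nonneg _) (h_pos t).le)
  have hint : ∀ t, Integrable fun x : EuclideanSpace ℝ (Fin (n + 1)) => r (x, t) := fun t =>
    (integrable_norm_sq_div hi (h_pos t)).const_mul (h t ^ (-(d : ℝ) / 2))
  have hw : w ≠ 0 := norm_pos_iff.1 (hwn ▸ hs)
  set c : ℝ := (2 * Real.pi) ^ (((n + 1 : ℕ) : ℝ) / 2)
  have hc : 0 < c := by positivity
  have hval : ∀ t, ∫ x : EuclideanSpace ℝ (Fin (n + 1)), r (x, t) * Real.cos ⟪w, x⟫ = c *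
      (√(h t) ^ (((n + 1 : ℕ) : ℤ) - (d : ℤ)) * besselIntegral φ (n + 1) (√(h t) * s)) := by
    intro t
    simp only [hrdef, mul_assoc]
    rw [integral_const_mul, integral_norm_sq_div_mul_cos_inner hi hw (h_pos t), hwn,
      ← rpow_neg_half_mul_sqrt_pow (h_pos t)]
    ring
  have key : ∀ ε : ℝ, ε ^ 2 = 1 → 0 ≤
      √(h 0) ^ (((n + 1 : ℕ) : ℤ) - (d : ℤ)) * besselIntegral φ (n + 1) (√(h 0) * s) +
      ε * (√(h t) ^ (((n + 1 : ℕ) : ℤ) - (d : ℤ)) * besselIntegral φ (n + 1) (√(h t) * s)) := by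
    intro ε hε
    have hεabs : |ε| = 1 := by
      rw [← sq_abs] at hε
      exact (pow_eq_one_iff_of_nonneg (abs_nonneg _) two_ne_zero).1 hε
    have h1 := integral_nonneg_of_sum_sub_nonneg (V := EuclideanSpace ℝ (Fin (n + 1)))
      (g := fun x => (r (x, 0) + ε * r (x, t)) * Real.cos ⟪w, x⟫) (C := r 0 + r 0)
      (((hcont 0).add ((continuous_const (y := ε)).mul (hcont t))).mul (by fun_prop)).measurable
      (((hint 0).add ((hint t).const_mul ε)).mul_cos_inner w)
      (fun x => by
        have h2 : |r (x, 0) + ε * r (x, t)| ≤ r 0 + r 0 :=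
          (abs_add_le _ _).trans (add_le_add (hr.abs_le_apply_zero _) (by
            rw [abs_mul, hεabs, one_mul]
            exact hr.abs_le_apply_zero _))
        rw [abs_mul]
        exact (mul_le_of_le_one_right (abs_nonneg _) (Real.abs_cos_le_one _)).trans h2)
      (fun N x => hr.sum_cos_nonneg (t := t) (fun x => by simp only [hrdef, ht]) w hε N x)
    have h3 : ∀ x : EuclideanSpace ℝ (Fin (n + 1)), (r (x, 0) + ε * r (x, t)) * Real.cos ⟪w, x⟫
        = r (x, 0) * Real.cos ⟪w, x⟫ + ε * (r (x, t) * Real.cos ⟪w, x⟫) := fun x => by ring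
    simp_rw [h3] at h1
    rw [integral_add ((hint 0).mul_cos_inner w) (((hint t).mul_cos_inner w).const_mul ε),
      integral_const_mul, hval, hval] at h1
    refine nonneg_of_mul_nonneg_right (?_ : 0 ≤ c * _) hc
    linarith
  rw [abs_le]
  constructor
  · linarith [key 1 (by norm_num)]
  · linarith [key (-1) (by norm_num)]

lemma abs_zpow_mul_besselIntegral_dilation_le {n : ℕ} (hnd : n + 1 ≤ d) (h_pos : ∀ t, 0 < h t)
    (φ_cont : ContinuousOn φ (Set.Ici 0)) (φ_zero : 0 < φ 0)
    (hK : IsPositiveDefiniteFun (fun p : EuclideanSpace ℝ (Fin d) × E =>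
      (((h p.2) ^ (-(d : ℝ) / 2) * φ (‖p.1‖ ^ 2 / h p.2) : ℝ) : ℂ)))
    (hi : Integrable (fun x : EuclideanSpace ℝ (Fin (n + 1)) => φ (‖x‖ ^ 2)))
    (t : E) {s : ℝ} (hs : 0 < s) :
    |(s * √(h t / h 0)) ^ (((n + 1 : ℕ) : ℤ) - (d : ℤ)) *
        besselIntegral φ (n + 1) (s * √(h t / h 0))| ≤
      s ^ (((n + 1 : ℕ) : ℤ) - (d : ℤ)) * besselIntegral φ (n + 1) s := by
  have h0 : 0 < √(h 0) := Real.sqrt_pos.2 (h_pos 0)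
  have hs' : 0 < s / √(h 0) := div_pos hs h0
  have h1 := abs_besselIntegral_sqrt_le hnd h_pos φ_cont φ_zero hK hi t hs'
  have e0 : √(h 0) * (s / √(h 0)) = s := mul_div_cancel₀ _ h0.ne'
  have et : √(h t) * (s / √(h 0)) = s * √(h t / h 0) := by
    rw [Real.sqrt_div (h_pos t).le]; ring
  have hz := zpow_pos hs' (((n + 1 : ℕ) : ℤ) - (d : ℤ))
  -- Multiplying by `(s / √(h 0)) ^ (m - d)` turns both powers into powers of the arguments of the
  -- Bessel integral.
  have h2 := mul_le_mul_of_nonneg_left h1 hz.le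
  rwa [← abs_of_pos hz, ← abs_mul, abs_of_pos hz, ← mul_assoc, ← mul_assoc, ← mul_zpow, ← mul_zpow,
    mul_comm _ (√(h 0)), mul_comm _ (√(h t)), e0, et] at h2
end

lemma exists_besselIntegral_ne {φ : ℝ → ℝ} (φ_cont : ContinuousOn φ (Set.Ici 0)) (φ_zero : φ 0 ≠ 0)
    {n : ℕ} (hi : Integrable (fun x : EuclideanSpace ℝ (Fin (n + 1)) => φ (‖x‖ ^ 2)))
    (c : ℝ) (k : ℕ) : ∃ s, 0 < s ∧ besselIntegral φ (n + 1) s ≠ c * s ^ k := by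
  by_contra hcon
  push Not at hcon
  set e : EuclideanSpace ℝ (Fin (n + 1)) := EuclideanSpace.single (0 : Fin (n + 1)) (1 : ℝ)
  have he : ‖e‖ = 1 := by simp [e]
  have hne : e ≠ 0 := norm_pos_iff.1 (he ▸ one_pos)
  set C : ℝ := (2 * Real.pi) ^ (((n + 1 : ℕ) : ℝ) / 2)
  have hC : 0 < C := by positivity
  have hlim := tendsto_integral_mul_cos_inner hi (fun x => by rw [norm_neg]) hne
  have hc : c = 0 := by
    -- For `s ≥ 1` the factor `s ^ k` is at least `1`, so the transform could not tend to zero if `c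
    -- ≠ 0`.
    have hev : ∀ᶠ s : ℝ in atTop, |C * c| ≤
        |∫ x : EuclideanSpace ℝ (Fin (n + 1)), φ (‖x‖ ^ 2) * Real.cos ⟪s • e, x⟫| := by
      filter_upwards [eventually_ge_atTop 1] with s hs
      have hs0 : 0 < s := one_pos.trans_le hs
      rw [integral_norm_sq_mul_cos_inner hi (smul_ne_zero hs0.ne' hne), norm_smul, he, mul_one,
        Real.norm_of_nonneg hs0.le, hcon s hs0, ← mul_assoc, abs_mul _ (s ^ k)]
      exact le_mul_of_one_le_right (abs_nonneg _)
        ((one_le_pow₀ hs).trans (le_abs_self _))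
    have hle := ge_of_tendsto hlim.abs hev
    rw [abs_zero] at hle
    have := abs_nonpos_iff.1 hle
    exact (mul_eq_zero.1 this).resolve_left hC.ne'
  have hzero := eq_zero_of_integral_mul_cos_inner_eq_zero
    (f := fun x : EuclideanSpace ℝ (Fin (n + 1)) => φ (‖x‖ ^ 2))
    (φ_cont.comp_continuous (f := fun x : EuclideanSpace ℝ (Fin (n + 1)) => ‖x‖ ^ 2) (by fun_prop)
      fun x => sq_nonneg ‖x‖) hi (fun x => by rw [norm_neg])
    (fun w hw => by
      rw [integral_norm_sq_mul_cos_inner hi hw, hcon _ (norm_pos_iff.2 hw), hc, zero_mul, mul_zero])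
  have := congrFun hzero 0
  simp at this
  exact φ_zero this

theorem theorem4p2 {E : Type*} [AddCommGroup E] [Module ℝ E] (d : ℕ)
    (h : E → ℝ) (φ : ℝ → ℝ)
    (h_cont : IsFinitelyContinuous h) (h_pos : ∀ t, 0 < h t) (h_nonconst : ∃ t, h t ≠ h 0)
    (φ_cont : ContinuousOn φ (Set.Ici 0)) (φ_zero : 0 < φ 0)
    (K_posDef : IsPositiveDefiniteFun (fun p : EuclideanSpace ℝ (Fin d) × E =>
      (((h p.2) ^ (-(d : ℝ) / 2) * φ (‖p.1‖ ^ 2 / h p.2) : ℝ) : ℂ)))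
    (m : ℕ) (hm : 1 ≤ m) (hmd : m ≤ d)
    (φ_int : MeasureTheory.IntegrableOn (fun u : ℝ => |φ (u ^ 2)| * u ^ (m - 1)) (Set.Ioi 0))
    (g_analytic : AnalyticOn ℝ (besselIntegral φ m) (Set.Ioi 0)) :
    StrictAntiOn (fun s : ℝ => s ^ ((m : ℤ) - (d : ℤ)) * besselIntegral φ m s) (Set.Ioi 0) ∧
      ∀ s : ℝ, 0 < s → 0 < besselIntegral φ m s := by
  obtain ⟨n, rfl⟩ : ∃ n, m = n + 1 := ⟨m - 1, by omega⟩
  have hi := integrable_norm_sq φ_cont φ_int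
  set G : ℝ → ℝ := fun s => s ^ (((n + 1 : ℕ) : ℤ) - (d : ℤ)) * besselIntegral φ (n + 1) s with hG
  have hdil : ∀ (t : E) (s : ℝ), 0 < s → |G (s * √(h t / h 0))| ≤ G s := fun t s hs =>
    abs_zpow_mul_besselIntegral_dilation_le hmd h_pos φ_cont φ_zero K_posDef hi t hs
  have hnonneg : ∀ s, 0 < s → 0 ≤ G s := fun s hs => (abs_nonneg _).trans (hdil 0 s hs)
  obtain ⟨t₀, ht₀⟩ := h_nonconst
  have hlt : h 0 < h t₀ := lt_of_le_of_ne
    (zero_le_of_isPositiveDefiniteFun (by omega) h_pos φ_zero K_posDef t₀) ht₀.symm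
  have hq₀ : 1 < √(h t₀ / h 0) := by
    rw [Real.lt_sqrt zero_le_one, one_pow]
    exact (one_lt_div (h_pos 0)).2 hlt
  have hanti : AntitoneOn G (Set.Ioi 0) := by
    refine antitoneOn_Ioi_of_dilation hq₀ fun s hs q hq => ?_
    -- Along `r • t₀`, `0 ≤ r ≤ 1`, the dilation factor runs continuously from `1` to `q₀`.
    have hivt := intermediate_value_Icc (zero_le_one' ℝ)
      (((h_cont.continuous_smul_right t₀).div_const (h 0)).sqrt).continuousOn
    simp only [zero_smul, one_smul, div_self (h_pos 0).ne', Real.sqrt_one] at hivt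
    obtain ⟨r, -, hr⟩ := hivt hq
    rw [← hr]
    exact (le_abs_self _).trans (hdil (r • t₀) s hs)
  have hGa : AnalyticOnNhd ℝ G (Set.Ioi 0) := by
    have hg := isOpen_Ioi.analyticOn_iff_analyticOnNhd.1 g_analytic
    intro s hs
    exact (analyticAt_id.zpow (ne_of_gt hs)).mul (hg s hs)
  have hstrict : StrictAntiOn G (Set.Ioi 0) := by
    refine (strictAntiOn_or_eqOn_const_of_analytic hanti hGa).resolve_right ?_
    rintro ⟨c, hc⟩
    obtain ⟨s, hs, hne⟩ := exists_besselIntegral_ne φ_cont φ_zero.ne' hi c (d - (n + 1))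
    refine hne ?_
    rw [← hc s hs, hG]
    simp only
    rw [← zpow_natCast, Nat.cast_sub hmd, mul_right_comm, ← zpow_add₀ hs.ne']
    simp
  refine ⟨hstrict, fun s hs => ?_⟩
  -- `0 ≤ G (s + 1) < G s`.
  have hpos : 0 < G s := (hnonneg (s + 1) (by linarith)).trans_lt
    (hstrict hs (show (0 : ℝ) < s + 1 by linarith) (by linarith))
  exact pos_of_mul_pos_right hpos (zpow_pos hs _).le
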